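/- For a complex $n\times n$ matrix $x$ with no eigenvalue in $]-\infty,0]$, let $\log(x)$ denote its principal logarithm, i.e. the unique complex $n\times n$ matrix $a$ such that $e^a=x$ and every eigenvalue $z$ of $a$ satisfies $-\pi<\operatorname{Im}(z)<\pi$. Let $x,y$ be complex $n\times n$ matrices such that none of $x$, $y$, $xy$ has an eigenvalue in $]-\infty,0]$, and such that $\log(xy)=\log(x)+\log(y)$. If $x$ and $y$ are simultaneously triangularizable, i.e. there is an invertible complex $n\times n$ matrix $P$ such that $P^{-1}xP$ and $P^{-1}yP$ are both upper triangular, then $xy=yx$. -/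

import Mathlib

/-- No eigenvalue of the complex matrix `x` lies in the half-line `]-∞, 0]`. -/
def NoNonposEigenvalue {n : ℕ} (x : Matrix (Fin n) (Fin n) ℂ) : Prop :=
  ∀ t : ℝ, t ≤ 0 → (t : ℂ) ∉ spectrum ℂ x

/-- `a` is a principal logarithm of `x`: `e ^ a = x`, and every eigenvalue of `a` lies in the open
strip `Im z ∈ ]-π, π[`. -/
def IsPrincipalLog {n : ℕ} (x a : Matrix (Fin n) (Fin n) ℂ) : Prop :=
  NormedSpace.exp a = x ∧ ∀ z ∈ spectrum ℂ a, -Real.pi < z.im ∧ z.im < Real.pi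

open Classical in
/-- The principal logarithm of a complex square matrix: the matrix `a` with `IsPrincipalLog x a`.
If `x` has no eigenvalue in `]-∞, 0]`, such a matrix exists and is unique; the value `0` is a
placeholder for matrices that have no principal logarithm. -/
noncomputable def principalLog {n : ℕ} (x : Matrix (Fin n) (Fin n) ℂ) : Matrix (Fin n) (Fin n) ℂ :=
  if h : ∃ a, IsPrincipalLog x a then h.choose else 0

/-- `x` and `y` are simultaneously triangularizable: a single change of basis makes both
upper triangular. -/
def SimultaneouslyTriangularizable {n : ℕ} (x y : Matrix (Fin n) (Fin n) ℂ) : Prop :=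
  ∃ P : Matrix (Fin n) (Fin n) ℂ, IsUnit P ∧
    (P⁻¹ * x * P).BlockTriangular id ∧ (P⁻¹ * y * P).BlockTriangular id

/-!
Let `a` and `b` be the logarithms of `x` and `y`. Each lies in every subalgebra containing its
exponential, so after a change of basis `a` and `b` are upper triangular. If `c = [a, b]` were
nonzero, compressing to the index interval `[i, j]` of a minimal nonzero entry of `c` would make `c`
a common eigenvector of the left and right multiplications by `a` and `b`. Then
`e ^ a * e ^ b * e ^ (-(a + b)) = 1 + (∫₀¹ r ψ(r q) e ^ (r p) dr) • c` with `ψ z = (e ^ z - 1) / z`,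
where `p` and `q` are the eigenvalues of `ad a` and `ad b` on `c`, and `q` times the integral is
`ψ (p + q) - ψ p`. An affine function with nonzero slope agrees with `exp` at no three points whose
imaginary parts differ by less than `2 π`; hence `ψ` separates `p` and `p + q`, which forces
`q = 0`. The same argument for `-b` and `-a` gives `p = 0`, but then the integral is `1 / 2`.
-/

open Complex (exp I)
open scoped Real ComplexConjugate Ring

theorem exists_mem_openSegment_apply_deriv_eq_zero (L : ℂ →L[ℝ] ℝ) {f f' : ℂ → ℂ} {s t : ℂ}
    (hf : ∀ z, HasDerivAt f (f' z) z) (hst : s ≠ t) (h : f s = f t) :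
    ∃ w ∈ openSegment ℝ s t, L (f' w) = 0 := by
  have hsub : t - s ≠ 0 := sub_ne_zero.mpr hst.symm
  have hderiv (r : ℝ) : HasDerivAt (fun r : ℝ ↦ L (f (AffineMap.lineMap s t r) / (t - s)))
      (L (f' (AffineMap.lineMap s t r))) r := by
    have hline : HasDerivAt (fun r : ℝ ↦ (AffineMap.lineMap s t r : ℂ)) (t - s) r :=
      AffineMap.hasDerivAt_lineMap
    have := ((hf _).comp r hline).div_const (t - s)
    rw [mul_div_cancel_right₀ _ hsub] at this
    exact L.hasFDerivAt.comp_hasDerivAt r this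
  obtain ⟨r, hr, hr0⟩ := exists_hasDerivAt_eq_zero zero_lt_one
    (fun r _ ↦ (hderiv r).continuousAt.continuousWithinAt) (by simp [h]) fun r _ ↦ hderiv r
  exact ⟨_, openSegment_eq_image_lineMap ℝ s t ▸ Set.mem_image_of_mem _ hr, hr0⟩

theorem sin_neg_iff_pi_lt {y : ℝ} (h0 : 0 ≤ y) (h : y < 2 * π) : Real.sin y < 0 ↔ π < y := by
  refine ⟨fun hsin ↦ ?_, fun hy ↦ ?_⟩
  · by_contra! hy
    exact hsin.not_ge (Real.sin_nonneg_of_nonneg_of_le_pi h0 hy)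
  · rw [← Real.sin_sub_two_pi]
    exact Real.sin_neg_of_neg_of_neg_pi_lt (by linarith) (by linarith)

theorem exp_sub_self_im (z : ℂ) : (exp z - z).im = Real.exp z.re * Real.sin z.im - z.im := by
  rw [Complex.sub_im, Complex.exp_im]

theorem pi_lt_im_iff {z : ℂ} (h0 : 0 ≤ z.im) (h : z.im < 2 * π) :
    π < z.im ↔ (exp z - z).im < -π := by
  rw [exp_sub_self_im]
  refine ⟨fun hz ↦ ?_, fun hz ↦ ?_⟩
  · have := mul_neg_of_pos_of_neg (Real.exp_pos z.re) ((sin_neg_iff_pi_lt h0 h).mpr hz)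
    linarith
  · by_contra! hle
    have := mul_nonneg (Real.exp_nonneg z.re) (Real.sin_nonneg_of_nonneg_of_le_pi h0 hle)
    linarith

theorem im_lt_pi_iff {z : ℂ} (h0 : 0 ≤ z.im) (h : z.im < 2 * π) :
    z.im < π ↔ -π < (exp z - z).im := by
  rw [exp_sub_self_im]
  refine ⟨fun hz ↦ ?_, fun hz ↦ ?_⟩
  · have := mul_nonneg (Real.exp_nonneg z.re) (Real.sin_nonneg_of_nonneg_of_le_pi h0 hz.le)
    linarith
  · by_contra! hle
    rw [← Real.sin_sub_two_pi] at hz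
    have := mul_nonpos_of_nonneg_of_nonpos (Real.exp_nonneg z.re)
      (Real.sin_nonpos_of_nonpos_of_neg_pi_le (x := z.im - 2 * π) (by linarith) (by linarith))
    linarith

theorem im_eq_and_sin_eq_zero_of_exp_sub_self_eq {s t : ℂ} (hs0 : 0 ≤ s.im) (hs : s.im < 2 * π)
    (ht0 : 0 ≤ t.im) (ht : t.im < 2 * π) (hst : s ≠ t) (h : exp s - s = exp t - t) :
    s.im = t.im ∧ Real.sin t.im = 0 := by
  obtain ⟨w, ⟨p, q, hp, hq, hpq, hw⟩, hw0⟩ :=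
    exists_mem_openSegment_apply_deriv_eq_zero Complex.imCLM
      (fun z ↦ (Complex.hasDerivAt_exp z).sub (hasDerivAt_id z)) hst h
  have hsin : Real.sin w.im = 0 := by simpa [Complex.exp_im, Real.exp_ne_zero] using hw0
  have hw_im : p * s.im + q * t.im = w.im := by simp [← hw]
  have hlt : s.im < π ↔ t.im < π := by rw [im_lt_pi_iff hs0 hs, h, im_lt_pi_iff ht0 ht]
  have hgt : π < s.im ↔ π < t.im := by rw [pi_lt_im_iff hs0 hs, h, pi_lt_im_iff ht0 ht]
  rcases lt_trichotomy t.im π with ht_im | ht_im | ht_im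
  · have hw_pi : w.im < π := by nlinarith [hlt.mpr ht_im]
    have := (Real.sin_eq_zero_iff_of_lt_of_lt (by nlinarith [Real.pi_pos]) hw_pi).mp hsin
    have ht_zero : t.im = 0 := by nlinarith
    exact ⟨by nlinarith, by simp [ht_zero]⟩
  · refine ⟨?_, by rw [ht_im, Real.sin_pi]⟩
    rw [ht_im]
    exact le_antisymm (not_lt.mp (hgt.not.mpr ht_im.not_gt)) (not_lt.mp (hlt.not.mpr ht_im.not_lt))
  · have hw_pi : π < w.im := by nlinarith [hgt.mpr ht_im]
    exact absurd hsin ((sin_neg_iff_pi_lt (by nlinarith) (by nlinarith)).mpr hw_pi).ne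

theorem re_mul_re_neg_of_exp_sub_self_eq {s t : ℂ} (hs0 : 0 ≤ s.im) (hs : s.im < 2 * π)
    (ht0 : 0 ≤ t.im) (ht : t.im < 2 * π) (hst : s ≠ t) (h : exp s - s = exp t - t) :
    s.im = 0 ∧ t.im = 0 ∧ s.re * t.re < 0 := by
  obtain ⟨him, hsin⟩ := im_eq_and_sin_eq_zero_of_exp_sub_self_eq hs0 hs ht0 ht hst h
  obtain ⟨w, ⟨p, q, hp, hq, hpq, hw⟩, hw0⟩ :=
    exists_mem_openSegment_apply_deriv_eq_zero Complex.reCLM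
      (fun z ↦ (Complex.hasDerivAt_exp z).sub (hasDerivAt_id z)) hst h
  have hw_im : w.im = t.im := by simp [← hw, him, ← add_mul, hpq]
  have hw_re : p * s.re + q * t.re = w.re := by simp [← hw]
  have hcos : Real.exp w.re * Real.cos t.im = 1 := by
    simpa [Complex.exp_re, hw_im, sub_eq_zero] using hw0
  rcases Real.sin_eq_zero_iff_cos_eq.mp hsin with hcos1 | hcos1
  · have ht_im : t.im = 0 :=
      (Real.cos_eq_one_iff_of_lt_of_lt (by linarith [Real.pi_pos]) ht).mp hcos1
    have hw0 : w.re = 0 := by simpa [hcos1] using hcos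
    have hne : s.re ≠ t.re := fun hre ↦ hst (Complex.ext hre him)
    have ht_ne : t.re ≠ 0 := by
      intro ht_re
      have hs_re : s.re = 0 := by simpa [ht_re, hw0, hp.ne'] using hw_re
      exact hne (hs_re.trans ht_re.symm)
    have hmul : p * (s.re * t.re) < 0 := by
      have : 0 < q * t.re ^ 2 := by positivity
      linear_combination t.re * hw_re + t.re * hw0 + this
    exact ⟨him.trans ht_im, ht_im, neg_of_mul_neg_right hmul hp.le⟩
  · linarith [hcos1 ▸ hcos, Real.exp_pos w.re]

theorem not_exp_sub_self_eq_of_monotone {t : Fin 3 → ℂ} {m : ℂ} (hinj : t.Injective)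
    (him : ∀ i j, (t i).im - (t j).im < 2 * π) (hmono : Monotone fun i ↦ (t i).im)
    (h0 : 0 ≤ (t 1).im) (h1 : (t 1).im < 2 * π) : ¬ ∀ i, exp (t i) - t i = m := by
  intro h
  have h01 : (t 0).im ≤ (t 1).im := hmono (by decide)
  have h12 : (t 1).im ≤ (t 2).im := hmono (by decide)
  have h02 := him 2 0
  have heq (i j) : exp (t i) - t i = exp (t j) - t j := (h i).trans (h j).symm
  have hne {i j : Fin 3} (hij : i ≠ j) : t i ≠ t j := hinj.ne hij
  rcases le_or_gt 0 (t 0).im with hnonneg | hneg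
  · obtain ⟨him0, -, hneg01⟩ := re_mul_re_neg_of_exp_sub_self_eq hnonneg (h01.trans_lt h1) h0 h1
      (hne (by decide)) (heq 0 1)
    have h2 : (t 2).im < 2 * π := by linarith
    obtain ⟨-, -, hneg02⟩ := re_mul_re_neg_of_exp_sub_self_eq hnonneg (h01.trans_lt h1)
      (h0.trans h12) h2 (hne (by decide)) (heq 0 2)
    obtain ⟨-, -, hneg12⟩ := re_mul_re_neg_of_exp_sub_self_eq h0 h1
      (h0.trans h12) h2 (hne (by decide)) (heq 1 2)
    nlinarith [mul_pos_of_neg_of_neg hneg01 hneg02, sq_nonneg ((t 0).re)]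
  · obtain ⟨him1, -, -⟩ := re_mul_re_neg_of_exp_sub_self_eq h0 h1 (h0.trans h12) (by linarith)
      (hne (by decide)) (heq 1 2)
    obtain ⟨him0, -, -⟩ := re_mul_re_neg_of_exp_sub_self_eq (s := conj (t 0)) (t := conj (t 1))
      (by simpa using hneg.le) (by rw [Complex.conj_im]; linarith) (by simp [him1])
      (by simp [him1, Real.pi_pos])
      ((starRingEnd ℂ).injective.ne (hne (by decide)))
      (by simpa [Complex.exp_conj] using congrArg conj (heq 0 1))
    simp [hneg.ne] at him0

theorem not_exp_sub_self_eq_of_injective {t : Fin 3 → ℂ} (m : ℂ) (hinj : t.Injective)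
    (him : ∀ i j, (t i).im - (t j).im < 2 * π) : ¬ ∀ i, exp (t i) - t i = m := by
  intro h
  set σ := Tuple.sort fun i ↦ (t i).im
  set k : ℤ := ⌊(t (σ 1)).im / (2 * π)⌋
  have hk_im : (k * (2 * π * I)).im = k * (2 * π) := by simp
  refine not_exp_sub_self_eq_of_monotone (t := fun i ↦ t (σ i) - k * (2 * π * I))
    (m := m + k * (2 * π * I))
    ((sub_left_injective).comp (hinj.comp σ.injective)) (fun i j ↦ ?_) (fun i j hij ↦ ?_) ?_ ?_
    fun i ↦ ?_
  · simpa only [Complex.sub_im, sub_sub_sub_cancel_right] using him (σ i) (σ j)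
  · simpa only [Complex.sub_im, sub_le_sub_iff_right, Function.comp_apply] using
      Tuple.monotone_sort (fun i ↦ (t i).im) hij
  · have := Int.floor_le ((t (σ 1)).im / (2 * π))
    rw [le_div_iff₀ Real.two_pi_pos] at this
    rw [Complex.sub_im, hk_im]
    linarith
  · have := Int.lt_floor_add_one ((t (σ 1)).im / (2 * π))
    rw [div_lt_iff₀ Real.two_pi_pos] at this
    rw [Complex.sub_im, hk_im]
    linarith
  · rw [Complex.exp_periodic.sub_int_mul_eq, ← h (σ i)]
    ring

theorem not_exp_eq_mul_add_of_injective {t : Fin 3 → ℂ} {k : ℂ} (hk : k ≠ 0) (c : ℂ)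
    (hinj : t.Injective) (him : ∀ i j, (t i).im - (t j).im < 2 * π) :
    ¬ ∀ i, exp (t i) = k * t i + c := by
  intro h
  refine not_exp_sub_self_eq_of_injective (t := fun i ↦ t i - Complex.log k)
    (Complex.log k + c / k) (sub_left_injective.comp hinj) (fun i j ↦ ?_) fun i ↦ ?_
  · simpa only [Complex.sub_im, sub_sub_sub_cancel_right] using him i j
  · rw [Complex.exp_sub, Complex.exp_log hk, h i]
    field_simp
    ring

section ExpSlope

variable {A : Type*} [NormedRing A] [NormedAlgebra ℂ A]

/-- The entire function `(exp z - 1) / z` evaluated at an element of a complex Banach algebra. -/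
noncomputable def expSlope (a : A) : A := ∫ t in (0 : ℝ)..1, NormedSpace.exp ((t : ℂ) • a)

variable [CompleteSpace A]

theorem hasDerivAt_exp_ofReal_smul (a : A) (r : ℝ) :
    HasDerivAt (fun r : ℝ ↦ NormedSpace.exp ((r : ℂ) • a))
      (a * NormedSpace.exp ((r : ℂ) • a)) r := by
  simpa only [Function.comp_def, Complex.ofRealCLM_apply, Complex.ofReal_one, one_smul] using
    (hasDerivAt_exp_smul_const' (𝕂 := ℂ) a (r : ℂ)).scomp r Complex.ofRealCLM.hasDerivAt

theorem continuous_exp_ofReal_smul (a : A) :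
    Continuous fun r : ℝ ↦ NormedSpace.exp ((r : ℂ) • a) :=
  continuous_iff_continuousAt.mpr fun r ↦ (hasDerivAt_exp_ofReal_smul a r).continuousAt

theorem map_expSlope {B : Type*} [NormedRing B] [NormedAlgebra ℂ B] [CompleteSpace B]
    (φ : A →ₐ[ℂ] B) (hφ : Continuous φ) (a : A) : φ (expSlope a) = expSlope (φ a) := by
  let : NormedAlgebra ℚ A := .restrictScalars ℚ ℂ A
  let : NormedAlgebra ℚ B := .restrictScalars ℚ ℂ B
  calc φ (expSlope a) = ∫ t in (0 : ℝ)..1, φ (NormedSpace.exp ((t : ℂ) • a)) :=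
        ((⟨φ.toLinearMap, hφ⟩ : A →L[ℂ] B).intervalIntegral_comp_comm
          ((continuous_exp_ofReal_smul a).intervalIntegrable 0 1)).symm
    _ = expSlope (φ a) := by simp_rw [NormedSpace.map_exp φ hφ, map_smul, expSlope]

theorem mul_expSlope (a : A) : a * expSlope a = NormedSpace.exp a - 1 := by
  have hcont := continuous_exp_ofReal_smul a
  calc a * expSlope a = ∫ t in (0 : ℝ)..1, a * NormedSpace.exp ((t : ℂ) • a) :=
        ((ContinuousLinearMap.mul ℂ A a).intervalIntegral_comp_comm
          (hcont.intervalIntegrable 0 1)).symm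
    _ = NormedSpace.exp a - 1 := by
        rw [intervalIntegral.integral_eq_sub_of_hasDerivAt
          (fun r _ ↦ hasDerivAt_exp_ofReal_smul a r)
          ((continuous_const.mul hcont).intervalIntegrable 0 1)]
        simp only [Complex.ofReal_one, one_smul, Complex.ofReal_zero, zero_smul,
          NormedSpace.exp_zero]

theorem expSlope_zero : expSlope (0 : A) = 1 := by
  simp [expSlope]

theorem hasDerivAt_smul_expSlope (a : A) (r : ℝ) :
    HasDerivAt (fun r : ℝ ↦ (r : ℂ) • expSlope ((r : ℂ) • a))
      (NormedSpace.exp ((r : ℂ) • a)) r := by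
  have heq (r : ℝ) : (r : ℂ) • expSlope ((r : ℂ) • a) =
      ∫ t in (0 : ℝ)..r, NormedSpace.exp ((t : ℂ) • a) := by
    have h := intervalIntegral.smul_integral_comp_mul_right (a := 0) (b := 1)
      (fun t : ℝ ↦ NormedSpace.exp ((t : ℂ) • a)) r
    simp only [zero_mul, one_mul, Complex.ofReal_mul, mul_smul] at h
    exact h
  simp_rw [heq]
  exact (continuous_exp_ofReal_smul a).integral_hasStrictDerivAt 0 r |>.hasDerivAt

end ExpSlope

section ScalarExpSlope

theorem expSlope_of_ne_zero {z : ℂ} (hz : z ≠ 0) : expSlope z = (exp z - 1) / z := by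
  rw [eq_div_iff hz, mul_comm, mul_expSlope, Complex.exp_eq_exp_ℂ]

theorem eq_zero_of_exp_eq_one {z : ℂ} (hz : |z.im| < 2 * π) (h : exp z = 1) : z = 0 := by
  obtain ⟨k, rfl⟩ := Complex.exp_eq_one_iff.mp h
  have hk : |(k : ℝ)| * (2 * π) < 1 * (2 * π) := by
    simpa [abs_mul, abs_of_pos Real.pi_pos] using hz
  have hk1 : |(k : ℝ)| < 1 := lt_of_mul_lt_mul_right hk (by positivity)
  have hk0 : k = 0 := Int.abs_lt_one_iff.mp (by exact_mod_cast hk1)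
  simp [hk0]

theorem expSlope_ne_zero {z : ℂ} (hz : |z.im| < 2 * π) : expSlope z ≠ 0 := by
  intro h
  have hexp : exp z = 1 := by
    rw [Complex.exp_eq_exp_ℂ, ← sub_eq_zero, ← mul_expSlope, h, mul_zero]
  rw [eq_zero_of_exp_eq_one hz hexp, expSlope_zero] at h
  exact one_ne_zero h

theorem expSlope_conj (z : ℂ) : expSlope (conj z) = conj (expSlope z) := by
  rcases eq_or_ne z 0 with rfl | hz
  · simp [expSlope_zero]
  · have hz' : conj z ≠ 0 := by simpa using hz
    simp [expSlope_of_ne_zero hz, expSlope_of_ne_zero hz', Complex.exp_conj]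

theorem eq_zero_of_expSlope_eq_one {z : ℂ} (hz : |z.im| < 2 * π) (h : expSlope z = 1) : z = 0 := by
  wlog him : 0 ≤ z.im generalizing z
  · simpa using this (z := conj z) (by simpa using hz) (by simp [expSlope_conj, h])
      (by simpa using (not_le.mp him).le)
  by_contra hne
  rw [expSlope_of_ne_zero hne, div_eq_one_iff_eq hne] at h
  have hfix : exp z - z = exp 0 - 0 := by
    rw [Complex.exp_zero, sub_zero]
    linear_combination h
  obtain ⟨-, -, hneg⟩ := re_mul_re_neg_of_exp_sub_self_eq him (abs_lt.mp hz).2 (t := 0) (by simp)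
    (by simpa using Real.pi_pos) hne hfix
  simp at hneg

theorem expSlope_injective {p q : ℂ} (hp : |p.im| < 2 * π) (hq : |q.im| < 2 * π)
    (hpq : |p.im - q.im| < 2 * π) (h : expSlope p = expSlope q) : p = q := by
  rcases eq_or_ne p 0 with rfl | hp0
  · exact (eq_zero_of_expSlope_eq_one hq (h.symm.trans expSlope_zero)).symm
  rcases eq_or_ne q 0 with rfl | hq0
  · exact eq_zero_of_expSlope_eq_one hp (h.trans expSlope_zero)
  by_contra hne
  have hinj : Function.Injective ![0, p, q] := by
    rw [Matrix.vecCons, Fin.cons_injective_iff, Matrix.vecCons, Fin.cons_injective_iff]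
    exact ⟨by simp [hp0.symm, hq0.symm], by simpa using hne, Function.injective_of_subsingleton _⟩
  refine not_exp_eq_mul_add_of_injective (expSlope_ne_zero hp) 1 hinj ?_ ?_
  · have := abs_lt.mp hp
    have := abs_lt.mp hq
    have := abs_lt.mp hpq
    intro i j
    fin_cases i <;> fin_cases j <;>
      simp only [Fin.zero_eta, Fin.mk_one, Fin.reduceFinMk, Matrix.cons_val, Complex.zero_im] <;>
      linarith
  · have hexp (z : ℂ) : exp z = expSlope z * z + 1 := by
      rw [mul_comm, mul_expSlope, Complex.exp_eq_exp_ℂ, sub_add_cancel]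
    intro i
    fin_cases i
    · simp
    · exact hexp p
    · rw [h]; exact hexp q

end ScalarExpSlope

section CommutatorEigenvector

variable {A : Type*} [NormedRing A] [NormedAlgebra ℂ A]

theorem exp_smul_one (z : ℂ) : NormedSpace.exp (z • (1 : A)) = exp z • (1 : A) := by
  rw [← Algebra.algebraMap_eq_smul_one, ← NormedSpace.algebraMap_exp_comm,
    Algebra.algebraMap_eq_smul_one, Complex.exp_eq_exp_ℂ]

variable [CompleteSpace A]

theorem exp_mul_of_mul_eq_smul {a c : A} {z : ℂ} (h : a * c = z • c) :
    NormedSpace.exp a * c = exp z • c := by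
  let : NormedAlgebra ℚ A := .restrictScalars ℚ ℂ A
  have hsemi : SemiconjBy c (z • 1) a := by simp [SemiconjBy, h]
  simpa [exp_smul_one] using hsemi.exp_right.eq.symm

theorem mul_exp_of_mul_eq_smul {a c : A} {z : ℂ} (h : c * a = z • c) :
    c * NormedSpace.exp a = exp z • c := by
  let : NormedAlgebra ℚ A := .restrictScalars ℚ ℂ A
  have hsemi : SemiconjBy c a (z • 1) := by simp [SemiconjBy, h]
  simpa [exp_smul_one] using hsemi.exp_right.eq

theorem exp_mul_exp_neg (a : A) : NormedSpace.exp a * NormedSpace.exp (-a) = 1 := by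
  let : NormedAlgebra ℚ A := .restrictScalars ℚ ℂ A
  rw [← NormedSpace.exp_add_of_commute (Commute.refl a).neg_right, add_neg_cancel,
    NormedSpace.exp_zero]

theorem hasDerivAt_exp_ofReal_smul' (a : A) (r : ℝ) :
    HasDerivAt (fun r : ℝ ↦ NormedSpace.exp ((r : ℂ) • a))
      (NormedSpace.exp ((r : ℂ) • a) * a) r := by
  simpa only [Function.comp_def, Complex.ofRealCLM_apply, Complex.ofReal_one, one_smul] using
    (hasDerivAt_exp_smul_const (𝕂 := ℂ) a (r : ℂ)).scomp r Complex.ofRealCLM.hasDerivAt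

theorem eq_of_hasDerivAt_eq {E : Type*} [NormedAddCommGroup E] [NormedSpace ℝ E] {f g f' : ℝ → E}
    (hf : ∀ r, HasDerivAt f (f' r) r) (hg : ∀ r, HasDerivAt g (f' r) r) (h : f 0 = g 0) :
    f = g := by
  funext r
  have hconst := is_const_of_deriv_eq_zero (f := f - g)
    (fun r ↦ ((hf r).sub (hg r)).differentiableAt)
    (fun r ↦ ((hf r).sub (hg r)).deriv.trans (sub_self _)) r 0
  simpa [h, sub_eq_zero] using hconst

theorem exp_mul_mul_exp_of_mul_eq_smul {a b c : A} {z w : ℂ} (hl : a * c = z • c)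
    (hr : c * b = w • c) : NormedSpace.exp a * c * NormedSpace.exp b = exp (z + w) • c := by
  rw [exp_mul_of_mul_eq_smul hl, smul_mul_assoc, mul_exp_of_mul_eq_smul hr, smul_smul,
    Complex.exp_add]

theorem exp_mul_mul_exp_neg {a b c : A} {a₁ a₂ : ℂ} (hc : a * b - b * a = c) (hl : a * c = a₁ • c)
    (hr : c * a = a₂ • c) :
    NormedSpace.exp a * b * NormedSpace.exp (-a) = b + expSlope (a₁ - a₂) • c := by
  have hleft (r : ℝ) : HasDerivAt
      (fun r : ℝ ↦ NormedSpace.exp ((r : ℂ) • a) * b * NormedSpace.exp ((r : ℂ) • -a))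
      (NormedSpace.exp ((r : ℂ) • (a₁ - a₂)) • c) r := by
    have hconj : NormedSpace.exp ((r : ℂ) • a) * c * NormedSpace.exp ((r : ℂ) • -a) =
        NormedSpace.exp ((r : ℂ) • (a₁ - a₂)) • c := by
      rw [exp_mul_mul_exp_of_mul_eq_smul (z := r * a₁) (w := r * -a₂)
        (by rw [smul_mul_assoc, hl, smul_smul])
        (by rw [mul_smul_comm, mul_neg, hr, ← neg_smul, smul_smul]),
        ← mul_add, ← sub_eq_add_neg, smul_eq_mul, Complex.exp_eq_exp_ℂ]
    rw [← hconj, ← hc]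
    refine (((hasDerivAt_exp_ofReal_smul' a r).mul_const b).mul
      (hasDerivAt_exp_ofReal_smul (-a) r)).congr_deriv ?_
    noncomm_ring
  have hright (r : ℝ) : HasDerivAt
      (fun r : ℝ ↦ b + ((r : ℂ) • expSlope ((r : ℂ) • (a₁ - a₂))) • c)
      (NormedSpace.exp ((r : ℂ) • (a₁ - a₂)) • c) r :=
    ((hasDerivAt_smul_expSlope (a₁ - a₂) r).smul_const c).const_add b
  simpa using congrFun (eq_of_hasDerivAt_eq hleft hright (by simp)) 1

theorem mul_exp_sub_exp_mul {a b c : A} {b₁ b₂ : ℂ} (hc : a * b - b * a = c) (hl : b * c = b₁ • c)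
    (hr : c * b = b₂ • c) :
    a * NormedSpace.exp b - NormedSpace.exp b * a = (expSlope (b₁ - b₂) * exp b₂) • c := by
  have hconj := exp_mul_mul_exp_neg (a := b) (b := a) (c := -c) (a₁ := b₁) (a₂ := b₂)
    (by rw [← hc, neg_sub]) (by rw [mul_neg, hl, smul_neg]) (by rw [neg_mul, hr, smul_neg])
  have hinv : NormedSpace.exp (-b) * NormedSpace.exp b = 1 := by
    simpa using exp_mul_exp_neg (-b)
  calc a * NormedSpace.exp b - NormedSpace.exp b * a
      = (a - NormedSpace.exp b * a * NormedSpace.exp (-b)) * NormedSpace.exp b := by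
        rw [sub_mul, mul_assoc _ (NormedSpace.exp (-b)), hinv, mul_one]
    _ = expSlope (b₁ - b₂) • (c * NormedSpace.exp b) := by
        rw [hconj, smul_neg, sub_add_cancel_left, neg_neg, smul_mul_assoc]
    _ = (expSlope (b₁ - b₂) * exp b₂) • c := by rw [mul_exp_of_mul_eq_smul hr, smul_smul]

/-- The scalar `(e ^ a * e ^ b * e ^ (-(a + b)) - 1) / c` for `c = a * b - b * a`, when
`a * c - c * a = p • c` and `b * c - c * b = q • c`. -/
noncomputable def expDefect (p q : ℂ) : ℂ :=
  ∫ r in (0 : ℝ)..1, (r : ℂ) * expSlope (r * q) * exp (r * p)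

theorem continuous_expDefect_integrand (p q : ℂ) :
    Continuous fun r : ℝ ↦ (r : ℂ) * expSlope (r * q) * exp (r * p) := by
  have : Continuous fun r : ℝ ↦ (r : ℂ) * expSlope (r * q) :=
    continuous_iff_continuousAt.mpr fun r ↦ (hasDerivAt_smul_expSlope q r).continuousAt
  fun_prop

theorem hasDerivAt_exp_mul_exp_mul_exp_neg_add {a b c : A} {a₁ a₂ b₁ b₂ : ℂ}
    (hc : a * b - b * a = c) (hal : a * c = a₁ • c) (har : c * a = a₂ • c) (hbl : b * c = b₁ • c)
    (hbr : c * b = b₂ • c) (r : ℝ) :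
    HasDerivAt (fun r : ℝ ↦ NormedSpace.exp ((r : ℂ) • a) * NormedSpace.exp ((r : ℂ) • b) *
        NormedSpace.exp ((r : ℂ) • -(a + b)))
      (((r : ℂ) * expSlope (r * (b₁ - b₂)) * exp (r * (a₁ - a₂))) • c) r := by
  have hcomm : a * NormedSpace.exp ((r : ℂ) • b) - NormedSpace.exp ((r : ℂ) • b) * a =
      ((r : ℂ) * expSlope (r * (b₁ - b₂)) * exp (r * b₂)) • c := by
    rw [mul_exp_sub_exp_mul (c := (r : ℂ) • c) (b₁ := r * b₁) (b₂ := r * b₂)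
      (by rw [mul_smul_comm, smul_mul_assoc, ← smul_sub, hc])
      (by rw [smul_mul_smul_comm, hbl, smul_smul, smul_smul, mul_right_comm])
      (by rw [smul_mul_smul_comm, hbr, smul_smul, smul_smul, mul_right_comm]), smul_smul, ← mul_sub]
    ring_nf
  have hconj : NormedSpace.exp ((r : ℂ) • a) * c * NormedSpace.exp ((r : ℂ) • -(a + b)) =
      exp (r * a₁ + r * -(a₂ + b₂)) • c :=
    exp_mul_mul_exp_of_mul_eq_smul (by rw [smul_mul_assoc, hal, smul_smul])
      (by rw [mul_smul_comm, mul_neg, mul_add, har, hbr, ← add_smul, ← neg_smul, smul_smul])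
  refine (((hasDerivAt_exp_ofReal_smul' a r).mul (hasDerivAt_exp_ofReal_smul' b r)).mul
    (hasDerivAt_exp_ofReal_smul (-(a + b)) r)).congr_deriv ?_
  calc _ = NormedSpace.exp ((r : ℂ) • a) *
        (a * NormedSpace.exp ((r : ℂ) • b) - NormedSpace.exp ((r : ℂ) • b) * a) *
        NormedSpace.exp ((r : ℂ) • -(a + b)) := by
        simp only [Pi.mul_apply]
        noncomm_ring
    _ = ((r : ℂ) * expSlope (r * (b₁ - b₂)) * exp (r * (a₁ - a₂))) • c := by
        rw [hcomm, mul_smul_comm, smul_mul_assoc, hconj, smul_smul, mul_assoc _ (exp _),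
          ← Complex.exp_add]
        ring_nf

theorem exp_mul_exp_mul_exp_neg_add {a b c : A} {a₁ a₂ b₁ b₂ : ℂ} (hc : a * b - b * a = c)
    (hal : a * c = a₁ • c) (har : c * a = a₂ • c) (hbl : b * c = b₁ • c) (hbr : c * b = b₂ • c) :
    NormedSpace.exp a * NormedSpace.exp b * NormedSpace.exp (-(a + b)) =
      1 + expDefect (a₁ - a₂) (b₁ - b₂) • c := by
  have hint := intervalIntegral.integral_eq_sub_of_hasDerivAt (a := 0) (b := 1)
    (fun r _ ↦ hasDerivAt_exp_mul_exp_mul_exp_neg_add hc hal har hbl hbr r)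
    (((continuous_expDefect_integrand _ _).smul continuous_const).intervalIntegrable 0 1)
  rw [intervalIntegral.integral_smul_const, ← expDefect] at hint
  simpa only [Complex.ofReal_one, one_smul, Complex.ofReal_zero, zero_smul, NormedSpace.exp_zero,
    mul_one, sub_eq_iff_eq_add'] using hint.symm

theorem expDefect_eq_zero_of_exp_add_eq {a b c : A} {a₁ a₂ b₁ b₂ : ℂ} (hc : a * b - b * a = c)
    (hal : a * c = a₁ • c) (har : c * a = a₂ • c) (hbl : b * c = b₁ • c) (hbr : c * b = b₂ • c)
    (hne : c ≠ 0) (hexp : NormedSpace.exp (a + b) = NormedSpace.exp a * NormedSpace.exp b) :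
    expDefect (a₁ - a₂) (b₁ - b₂) = 0 := by
  have hprod := exp_mul_exp_mul_exp_neg_add hc hal har hbl hbr
  rwa [← hexp, exp_mul_exp_neg, left_eq_add, smul_eq_zero_iff_left hne] at hprod

theorem exp_neg_add_neg_of_exp_add_eq {a b : A}
    (hexp : NormedSpace.exp (a + b) = NormedSpace.exp a * NormedSpace.exp b) :
    NormedSpace.exp (-b + -a) = NormedSpace.exp (-b) * NormedSpace.exp (-a) := by
  rw [← neg_add_rev]
  refine left_inv_eq_right_inv (a := NormedSpace.exp (a + b)) ?_ ?_
  · simpa using exp_mul_exp_neg (-(a + b))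
  · rw [hexp, mul_assoc, ← mul_assoc (NormedSpace.exp b), exp_mul_exp_neg, one_mul,
      exp_mul_exp_neg]

end CommutatorEigenvector

theorem mul_expDefect (p q : ℂ) : q * expDefect p q = expSlope (p + q) - expSlope p := by
  have hintegrand (r : ℝ) : q * ((r : ℂ) * expSlope (r * q) * exp (r * p)) =
      NormedSpace.exp ((r : ℂ) • (p + q)) - NormedSpace.exp ((r : ℂ) • p) := by
    have hmul := mul_expSlope ((r : ℂ) * q)
    rw [← Complex.exp_eq_exp_ℂ] at hmul ⊢
    rw [smul_eq_mul, smul_eq_mul, mul_add, Complex.exp_add]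
    linear_combination exp (r * p) * hmul
  rw [expDefect, ← intervalIntegral.integral_const_mul, funext hintegrand,
    intervalIntegral.integral_sub ((continuous_exp_ofReal_smul _).intervalIntegrable 0 1)
      ((continuous_exp_ofReal_smul _).intervalIntegrable 0 1), expSlope, expSlope]

theorem expDefect_zero_zero : expDefect 0 0 = 1 / 2 := by
  simp only [expDefect, mul_zero, expSlope_zero, Complex.exp_zero, mul_one]
  rw [intervalIntegral.integral_ofReal, integral_id]
  norm_num

theorem eq_zero_of_expDefect_eq_zero {p q : ℂ} (hp : |p.im| < 2 * π) (hpq : |(p + q).im| < 2 * π)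
    (hq : |q.im| < 2 * π) (h : expDefect p q = 0) : q = 0 := by
  have hslope : expSlope (p + q) = expSlope p := by
    rw [← sub_eq_zero, ← mul_expDefect, h, mul_zero]
  simpa using expSlope_injective hpq hp (by simpa using hq) hslope

theorem commute_of_exp_add_eq {A : Type*} [NormedRing A] [NormedAlgebra ℂ A] [CompleteSpace A]
    {a b c : A} {a₁ a₂ b₁ b₂ : ℂ} (hc : a * b - b * a = c)
    (hal : a * c = a₁ • c) (har : c * a = a₂ • c) (hbl : b * c = b₁ • c) (hbr : c * b = b₂ • c)
    (ha : |(a₁ - a₂).im| < 2 * π) (hb : |(b₁ - b₂).im| < 2 * π)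
    (hab : |(a₁ - a₂ + (b₁ - b₂)).im| < 2 * π)
    (hexp : NormedSpace.exp (a + b) = NormedSpace.exp a * NormedSpace.exp b) : Commute a b := by
  by_contra hcomm
  have hne : c ≠ 0 := by
    rwa [← hc, sub_ne_zero]
  have hab0 := expDefect_eq_zero_of_exp_add_eq hc hal har hbl hbr hne hexp
  have hba0 : expDefect (-(b₁ - b₂)) (-(a₁ - a₂)) = 0 := by
    rw [neg_sub', neg_sub']
    refine expDefect_eq_zero_of_exp_add_eq (a := -b) (b := -a) (c := -c)
      (by rw [← hc]; noncomm_ring)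
      ?_ ?_ ?_ ?_ (neg_ne_zero.mpr hne) (exp_neg_add_neg_of_exp_add_eq hexp)
    all_goals simp [*]
  have hb0 := eq_zero_of_expDefect_eq_zero ha hab hb hab0
  have ha0 := eq_zero_of_expDefect_eq_zero (by rwa [Complex.neg_im, abs_neg])
    (by rwa [← neg_add, Complex.neg_im, abs_neg, add_comm])
    (by rwa [Complex.neg_im, abs_neg]) hba0
  rw [neg_eq_zero.mp ha0, hb0, expDefect_zero_zero] at hab0
  norm_num at hab0

section CommutativeBanachAlgebra

variable {B : Type*} [NormedCommRing B] [NormedAlgebra ℂ B] [CompleteSpace B]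

theorem mem_spectrum_iff_exists_algHom {a : B} {z : ℂ} :
    z ∈ spectrum ℂ a ↔ ∃ φ : B →ₐ[ℂ] ℂ, φ a = z := by
  refine ⟨fun hz ↦ ?_, fun ⟨φ, hφ⟩ ↦ hφ ▸ AlgHom.apply_mem_spectrum φ a⟩
  obtain ⟨φ, hφ⟩ := WeakDual.CharacterSpace.mem_spectrum_iff_exists.mp hz
  exact ⟨WeakDual.CharacterSpace.toAlgHom φ, hφ⟩

theorem isUnit_of_forall_algHom_ne_zero {a : B} (h : ∀ φ : B →ₐ[ℂ] ℂ, φ a ≠ 0) : IsUnit a := by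
  by_contra ha
  obtain ⟨φ, hφ⟩ := mem_spectrum_iff_exists_algHom.mp (spectrum.zero_mem_iff ℂ |>.mpr ha)
  exact h φ hφ

theorem isUnit_expSlope {d : B} (hd : ∀ z ∈ spectrum ℂ d, |z.im| < 2 * π) :
    IsUnit (expSlope d) := by
  refine isUnit_of_forall_algHom_ne_zero fun φ ↦ ?_
  rw [map_expSlope φ (map_continuous φ)]
  exact expSlope_ne_zero (hd _ (AlgHom.apply_mem_spectrum φ d))

theorem exp_injOn_strip :
    Set.InjOn NormedSpace.exp {a : B | ∀ z ∈ spectrum ℂ a, |z.im| < π} := by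
  intro a ha b hb h
  have hd (z : ℂ) (hz : z ∈ spectrum ℂ (a - b)) : |z.im| < 2 * π := by
    obtain ⟨φ, rfl⟩ := mem_spectrum_iff_exists_algHom.mp hz
    have := ha _ (AlgHom.apply_mem_spectrum φ a)
    have := hb _ (AlgHom.apply_mem_spectrum φ b)
    rw [map_sub, Complex.sub_im, two_mul]
    exact (abs_sub _ _).trans_lt (by linarith)
  have hexp : NormedSpace.exp (a - b) = 1 := by
    let : NormedAlgebra ℚ B := .restrictScalars ℚ ℂ B
    rw [sub_eq_add_neg, NormedSpace.exp_add, h, exp_mul_exp_neg]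
  have hmul : (a - b) * expSlope (a - b) = 0 := by rw [mul_expSlope, hexp, sub_self]
  exact sub_eq_zero.mp ((isUnit_expSlope hd).mul_left_eq_zero.mp hmul)

theorem spectrum_exp_subset_slitPlane {a : B} (ha : ∀ z ∈ spectrum ℂ a, |z.im| < π) :
    spectrum ℂ (NormedSpace.exp a) ⊆ Complex.slitPlane := by
  intro z hz
  obtain ⟨φ, rfl⟩ := mem_spectrum_iff_exists_algHom.mp hz
  let : NormedAlgebra ℚ B := .restrictScalars ℚ ℂ B
  have him := abs_lt.mp (ha _ (AlgHom.apply_mem_spectrum φ a))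
  rw [NormedSpace.map_exp φ (map_continuous φ), ← Complex.exp_eq_exp_ℂ, Complex.exp_mem_slitPlane,
    (toIocMod_eq_self Real.two_pi_pos).mpr ⟨him.1, by linarith⟩]
  exact him.2.ne

/-- The integral `∫₀ˢ (x - 1) (1 + t (x - 1))⁻¹ dt`, a logarithm of `1 + s (x - 1)`. -/
noncomputable def segmentLog (x : B) (s : ℝ) : B :=
  ∫ t in (0 : ℝ)..s, (x - 1) * (1 + (t : ℂ) • (x - 1))⁻¹ʳ

theorem isUnit_one_add_smul_sub_one {x : B} (hx : spectrum ℂ x ⊆ Complex.slitPlane) {t : ℝ}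
    (ht : t ∈ Set.Icc (0 : ℝ) 1) : IsUnit (1 + (t : ℂ) • (x - 1)) := by
  refine isUnit_of_forall_algHom_ne_zero fun φ ↦ Complex.slitPlane_ne_zero ?_
  simpa only [map_add, map_one, map_smul, map_sub, Complex.real_smul, smul_eq_mul] using
    Complex.starConvex_one_slitPlane.add_smul_sub_mem (hx (AlgHom.apply_mem_spectrum φ x)) ht.1 ht.2

theorem continuousAt_segmentLog_integrand {x : B} {t : ℝ} (h : IsUnit (1 + (t : ℂ) • (x - 1))) :
    ContinuousAt (fun t : ℝ ↦ (x - 1) * (1 + (t : ℂ) • (x - 1))⁻¹ʳ) t := by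
  obtain ⟨u, hu⟩ := h
  have hinv := NormedRing.inverse_continuousAt u
  rw [hu] at hinv
  exact continuousAt_const.mul
    (hinv.comp (f := fun t : ℝ ↦ 1 + (t : ℂ) • (x - 1)) (by fun_prop))

theorem intervalIntegrable_segmentLog_integrand {x : B} (hx : spectrum ℂ x ⊆ Complex.slitPlane)
    {s : ℝ} (hs : s ∈ Set.Icc (0 : ℝ) 1) :
    IntervalIntegrable (fun t : ℝ ↦ (x - 1) * (1 + (t : ℂ) • (x - 1))⁻¹ʳ)
      MeasureTheory.volume 0 s := by
  refine ContinuousOn.intervalIntegrable_of_Icc hs.1 fun t ht ↦ ?_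
  exact (continuousAt_segmentLog_integrand
    (isUnit_one_add_smul_sub_one hx ⟨ht.1, ht.2.trans hs.2⟩)).continuousWithinAt

theorem hasDerivAt_segmentLog {x : B} (hx : spectrum ℂ x ⊆ Complex.slitPlane) {s : ℝ}
    (hs : s ∈ Set.Icc (0 : ℝ) 1) :
    HasDerivAt (segmentLog x) ((x - 1) * (1 + (s : ℂ) • (x - 1))⁻¹ʳ) s := by
  have hs_unit := isUnit_one_add_smul_sub_one hx hs
  have hopen : IsOpen {t : ℝ | IsUnit (1 + (t : ℂ) • (x - 1))} :=
    Units.isOpen.preimage (by fun_prop : Continuous fun t : ℝ ↦ 1 + (t : ℂ) • (x - 1))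
  exact intervalIntegral.integral_hasDerivAt_right (intervalIntegrable_segmentLog_integrand hx hs)
    (ContinuousAt.stronglyMeasurableAtFilter hopen
      (fun _ ht ↦ continuousAt_segmentLog_integrand ht) s hs_unit)
    (continuousAt_segmentLog_integrand hs_unit)

theorem exp_segmentLog_one {x : B} (hx : spectrum ℂ x ⊆ Complex.slitPlane) :
    NormedSpace.exp (segmentLog x 1) = x := by
  set y : ℝ → B := fun s ↦ NormedSpace.exp (-segmentLog x s) * (1 + (s : ℂ) • (x - 1))
  have hy {s : ℝ} (hs : s ∈ Set.Icc (0 : ℝ) 1) : HasDerivAt y 0 s := by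
    have hexp := (hasFDerivAt_exp (𝕂 := ℝ) (x := -segmentLog x s)).comp_hasDerivAt s
      (hasDerivAt_segmentLog hx hs).neg
    have hline : HasDerivAt (fun s : ℝ ↦ 1 + (s : ℂ) • (x - 1)) (x - 1) s := by
      simpa using ((Complex.ofRealCLM.hasDerivAt (x := s)).smul_const (x - 1)).const_add 1
    refine (hexp.mul hline).congr_deriv ?_
    have hinv := Ring.inverse_mul_cancel _ (isUnit_one_add_smul_sub_one hx hs)
    simp only [Complex.coe_smul, smul_apply, one_apply_eq_self, smul_eq_mul, mul_neg, neg_mul,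
      Function.comp_apply, Pi.neg_apply]
    linear_combination (-NormedSpace.exp (-segmentLog x s) * (x - 1)) * hinv
  have hconst : y 1 = y 0 := constant_of_has_deriv_right_zero (a := 0) (b := 1)
    (fun s hs ↦ (hy hs).continuousAt.continuousWithinAt)
    (fun s hs ↦ (hy ⟨hs.1, hs.2.le⟩).hasDerivWithinAt) 1 (Set.right_mem_Icc.mpr zero_le_one)
  have hexp_neg : NormedSpace.exp (-segmentLog x 1) * x = 1 := by
    simpa [y, segmentLog] using hconst
  calc NormedSpace.exp (segmentLog x 1)
      = NormedSpace.exp (segmentLog x 1) * (NormedSpace.exp (-segmentLog x 1) * x) := by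
        rw [hexp_neg, mul_one]
    _ = x := by rw [← mul_assoc, exp_mul_exp_neg, one_mul]

theorem algHom_segmentLog_one {x : B} (hx : spectrum ℂ x ⊆ Complex.slitPlane) (φ : B →ₐ[ℂ] ℂ) :
    φ (segmentLog x 1) = Complex.log (φ x) := by
  have hφx : φ x ∈ Complex.slitPlane := hx (AlgHom.apply_mem_spectrum φ x)
  have hlog := Complex.log_eq_integral (z := φ x - 1) (by rwa [add_sub_cancel])
  rw [add_sub_cancel, ← intervalIntegral.integral_const_mul] at hlog
  calc φ (segmentLog x 1)
      = ∫ t in (0 : ℝ)..1, φ ((x - 1) * (1 + (t : ℂ) • (x - 1))⁻¹ʳ) :=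
        ((⟨φ.toLinearMap, map_continuous φ⟩ : B →L[ℂ] ℂ).intervalIntegral_comp_comm
          (intervalIntegrable_segmentLog_integrand hx (Set.right_mem_Icc.mpr zero_le_one))).symm
    _ = ∫ t in (0 : ℝ)..1, (φ x - 1) * (1 + t • (φ x - 1))⁻¹ := by
        refine intervalIntegral.integral_congr fun t ht ↦ ?_
        rw [Set.uIcc_of_le zero_le_one] at ht
        have hinv := congrArg φ (Ring.mul_inverse_cancel _ (isUnit_one_add_smul_sub_one hx ht))
        simp only [map_mul, map_add, map_one, map_smul, map_sub, smul_eq_mul] at hinv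
        simp only [map_mul, map_sub, map_one, Complex.real_smul, eq_inv_of_mul_eq_one_right hinv]
    _ = Complex.log (φ x) := hlog.symm

theorem exists_exp_eq_of_spectrum_subset_slitPlane {x : B}
    (hx : spectrum ℂ x ⊆ Complex.slitPlane) :
    ∃ a, NormedSpace.exp a = x ∧ ∀ z ∈ spectrum ℂ a, |z.im| < π := by
  refine ⟨segmentLog x 1, exp_segmentLog_one hx, fun z hz ↦ ?_⟩
  obtain ⟨φ, rfl⟩ := mem_spectrum_iff_exists_algHom.mp hz
  have hφx : φ x ∈ Complex.slitPlane := hx (AlgHom.apply_mem_spectrum φ x)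
  rw [algHom_segmentLog_one hx, Complex.log_im, abs_lt]
  exact ⟨Complex.neg_pi_lt_arg _,
    (Complex.arg_le_pi _).lt_of_ne (Complex.slitPlane_arg_ne_pi hφx)⟩

end CommutativeBanachAlgebra

theorem isUnit_subalgebra_iff {K A : Type*} [Field K] [Ring A] [Algebra K A] [FiniteDimensional K A]
    {S : Subalgebra K A} {a : S} : IsUnit a ↔ IsUnit (a : A) := by
  refine ⟨fun h ↦ h.map S.val, fun h ↦ ?_⟩
  have : IsArtinianRing S := IsArtinianRing.of_finite K S
  refine IsArtinianRing.isUnit_iff_isRightRegular.mpr fun b c hbc ↦ Subtype.ext ?_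
  exact h.isRegular.right (congrArg Subtype.val hbc)

theorem spectrum_subalgebra {K A : Type*} [Field K] [Ring A] [Algebra K A] [FiniteDimensional K A]
    {S : Subalgebra K A} (a : S) : spectrum K (a : A) = spectrum K a := by
  ext z
  rw [spectrum.mem_iff, spectrum.mem_iff, isUnit_subalgebra_iff]
  rfl

section FiniteDimensionalAlgebra

variable {A : Type*} [NormedRing A] [NormedAlgebra ℂ A] [FiniteDimensional ℂ A]

theorem coe_exp_subalgebra {S : Subalgebra ℂ A} (a : S) :
    (NormedSpace.exp a : S) = NormedSpace.exp (a : A) := by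
  have : CompleteSpace S := FiniteDimensional.complete ℂ S
  let : NormedAlgebra ℚ A := .restrictScalars ℚ ℂ A
  let : NormedAlgebra ℚ S := .restrictScalars ℚ ℂ S
  exact NormedSpace.map_exp S.val continuous_subtype_val a

theorem exp_algHom_add_eq {B : Type*} [NormedRing B] [NormedAlgebra ℂ B]
    {S : Subalgebra ℂ A} (φ : S →ₐ[ℂ] B) {a b : S}
    (h : NormedSpace.exp (a + b : A) = NormedSpace.exp (a : A) * NormedSpace.exp (b : A)) :
    NormedSpace.exp (φ a + φ b) = NormedSpace.exp (φ a) * NormedSpace.exp (φ b) := by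
  have : CompleteSpace S := FiniteDimensional.complete ℂ S
  let : NormedAlgebra ℚ S := .restrictScalars ℚ ℂ S
  let : NormedAlgebra ℚ B := .restrictScalars ℚ ℂ B
  have hφ : Continuous φ := φ.toLinearMap.continuous_of_finiteDimensional
  have hS : NormedSpace.exp (a + b) = NormedSpace.exp a * NormedSpace.exp b :=
    Subtype.ext (by
      rw [MulMemClass.coe_mul, coe_exp_subalgebra, coe_exp_subalgebra, coe_exp_subalgebra]
      exact h)
  rw [← map_add, ← NormedSpace.map_exp φ hφ, hS, map_mul, NormedSpace.map_exp φ hφ,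
    NormedSpace.map_exp φ hφ]

noncomputable instance (x : A) : NormedCommRing (Algebra.elemental ℂ x) where
  mul_comm := mul_comm

theorem exists_mem_elemental_exp_eq {x : A} (hx : spectrum ℂ x ⊆ Complex.slitPlane) :
    ∃ a ∈ Algebra.elemental ℂ x, NormedSpace.exp a = x ∧ ∀ z ∈ spectrum ℂ a, |z.im| < π := by
  have : CompleteSpace (Algebra.elemental ℂ x) := FiniteDimensional.complete ℂ _
  let x' : Algebra.elemental ℂ x := ⟨x, Algebra.elemental.self_mem ℂ x⟩
  obtain ⟨a, hexp, hstrip⟩ :=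
    exists_exp_eq_of_spectrum_subset_slitPlane (x := x') (by rwa [← spectrum_subalgebra])
  refine ⟨a, a.2, ?_, by rwa [spectrum_subalgebra]⟩
  rw [← coe_exp_subalgebra, hexp]

theorem mem_elemental_exp {a : A} (ha : ∀ z ∈ spectrum ℂ a, |z.im| < π) :
    a ∈ Algebra.elemental ℂ (NormedSpace.exp a) := by
  have : CompleteSpace (Algebra.elemental ℂ a) := FiniteDimensional.complete ℂ _
  let a' : Algebra.elemental ℂ a := ⟨a, Algebra.elemental.self_mem ℂ a⟩
  have ha' : ∀ z ∈ spectrum ℂ a', |z.im| < π := by rwa [← spectrum_subalgebra]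
  have hexp : (NormedSpace.exp a' : Algebra.elemental ℂ a) = NormedSpace.exp a :=
    coe_exp_subalgebra a'
  have hslit : spectrum ℂ (NormedSpace.exp a) ⊆ Complex.slitPlane := by
    rw [← hexp, spectrum_subalgebra]
    exact spectrum_exp_subset_slitPlane ha'
  obtain ⟨b, hb, hexp_b, hstrip⟩ := exists_mem_elemental_exp_eq hslit
  have hle : Algebra.elemental ℂ (NormedSpace.exp a) ≤ Algebra.elemental ℂ a :=
    Algebra.elemental.le_of_mem (Algebra.elemental.isClosed ℂ a) (hexp ▸ Subtype.property _)
  let b' : Algebra.elemental ℂ a := ⟨b, hle hb⟩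
  have hab : b' = a' := by
    refine exp_injOn_strip (fun z hz ↦ hstrip z ?_) ha' (Subtype.ext ?_)
    · rwa [← spectrum_subalgebra b'] at hz
    · rw [hexp, coe_exp_subalgebra, hexp_b]
  have hba : b = a := congrArg Subtype.val hab
  exact hba ▸ hb

theorem mem_of_exp_mem {S : Subalgebra ℂ A} {a : A} (ha : ∀ z ∈ spectrum ℂ a, |z.im| < π)
    (h : NormedSpace.exp a ∈ S) : a ∈ S :=
  Algebra.elemental.le_of_mem (Submodule.closed_of_finiteDimensional S.toSubmodule) h
    (mem_elemental_exp ha)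

end FiniteDimensionalAlgebra

section UpperTriangular

theorem mul_single_eq_smul {ι R : Type*} [Fintype ι] [DecidableEq ι] [Semiring R]
    {x : Matrix ι ι R} {i : ι} (hx : ∀ k ≠ i, x k i = 0) (j : ι) (r : R) :
    x * Matrix.single i j r = x i i • Matrix.single i j r := by
  ext k l
  rcases eq_or_ne l j with rfl | hl
  · rcases eq_or_ne k i with rfl | hk
    · simp
    · simp [hx k hk, hk.symm]
  · simp [hl, hl.symm]

theorem single_mul_eq_smul {ι R : Type*} [Fintype ι] [DecidableEq ι] [CommSemiring R]
    {x : Matrix ι ι R} {j : ι} (hx : ∀ k ≠ j, x j k = 0) (i : ι) (r : R) :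
    Matrix.single i j r * x = x j j • Matrix.single i j r := by
  have h := mul_single_eq_smul (x := x.transpose) hx i r
  simpa only [Matrix.transpose_mul, Matrix.transpose_single, Matrix.transpose_transpose,
    Matrix.transpose_smul, Matrix.transpose_apply] using congrArg Matrix.transpose h

variable {ι : Type*} [Fintype ι] [LinearOrder ι]

theorem submatrix_mul_of_isUpperTriangular {R : Type*} [Semiring R] {a b : Matrix ι ι R}
    (ha : a.IsUpperTriangular) (hb : b.IsUpperTriangular) (s : Set ι) [s.OrdConnected]
    [Fintype s] :
    (a * b).submatrix (Subtype.val : s → ι) (Subtype.val : s → ι) =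
      a.submatrix Subtype.val Subtype.val * b.submatrix Subtype.val Subtype.val := by
  ext i j
  simp only [Matrix.submatrix_apply, Matrix.mul_apply]
  refine (Fintype.sum_of_injective Subtype.val Subtype.val_injective _ _ (fun k hk ↦ ?_)
    fun _ ↦ rfl).symm
  by_contra hne
  have hik : i ≤ k := not_lt.mp fun h ↦ hne (by rw [ha h, zero_mul])
  have hkj : k ≤ j := not_lt.mp fun h ↦ hne (by rw [hb h, mul_zero])
  exact hk ⟨⟨k, Set.OrdConnected.out' i.2 j.2 ⟨hik, hkj⟩⟩, rfl⟩

/-- The compression of upper triangular matrices to an interval `s` of indices. It is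
multiplicative because `a k l * b l m = 0` unless `k ≤ l ≤ m`. -/
def intervalCompression (R : Type*) [CommSemiring R] (s : Set ι) [s.OrdConnected] [Fintype s] :
    Matrix.blockTriangularSubalgebra R R (id : ι → ι) →ₐ[R] Matrix s s R :=
  AlgHom.ofLinearMap
    { toFun := fun a ↦ (a : Matrix ι ι R).submatrix Subtype.val Subtype.val
      map_add' := fun _ _ ↦ rfl
      map_smul' := fun _ _ ↦ rfl }
    (Matrix.submatrix_one _ Subtype.val_injective)
    fun a b ↦ submatrix_mul_of_isUpperTriangular a.2 b.2 s

theorem diag_mem_spectrum_of_isUpperTriangular {K : Type*} [Field K] {a : Matrix ι ι K}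
    (ha : a.IsUpperTriangular) (i : ι) : a i i ∈ spectrum K a := by
  rw [spectrum.mem_iff, Matrix.isUnit_iff_isUnit_det, Matrix.det_of_isUpperTriangular
    ((Matrix.blockTriangular_algebraMap (a i i)).sub ha), isUnit_iff_ne_zero, not_not]
  exact Finset.prod_eq_zero (Finset.mem_univ i) (by simp [Matrix.algebraMap_matrix_apply])

open scoped Matrix.Norms.Operator

theorem commutator_apply_eq_zero_of_exp_add_eq
    {a b : Matrix.blockTriangularSubalgebra ℂ ℂ (id : ι → ι)}
    (hexp : NormedSpace.exp (a + b : Matrix ι ι ℂ) = NormedSpace.exp a.1 * NormedSpace.exp b.1)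
    {i j : ι} (hcorner : ∀ k ∈ Set.Icc i j, ∀ l ∈ Set.Icc i j, (k, l) ≠ (i, j) →
      (a * b - b * a : Matrix ι ι ℂ) k l = 0)
    (ha : |(a.1 i i - a.1 j j).im| < 2 * π) (hb : |(b.1 i i - b.1 j j).im| < 2 * π)
    (hab : |(a.1 i i - a.1 j j + (b.1 i i - b.1 j j)).im| < 2 * π) :
    (a * b - b * a : Matrix ι ι ℂ) i j = 0 := by
  set c : Matrix ι ι ℂ := a * b - b * a
  rcases lt_or_ge j i with hji | hij
  · exact (a * b - b * a).2 hji
  let φ := intervalCompression ℂ (Set.Icc i j)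
  let i' : Set.Icc i j := ⟨i, Set.left_mem_Icc.mpr hij⟩
  let j' : Set.Icc i j := ⟨j, Set.right_mem_Icc.mpr hij⟩
  have hcomm : φ a * φ b - φ b * φ a = Matrix.single i' j' (c i j) := by
    rw [← map_mul, ← map_mul, ← map_sub]
    ext k l
    by_cases hkl : k = i' ∧ l = j'
    · rw [hkl.1, hkl.2, Matrix.single_apply_same]
      rfl
    · rw [Matrix.single_apply_of_ne _ _ _ _ _ fun h ↦ hkl ⟨h.1.symm, h.2.symm⟩]
      refine hcorner k k.2 l l.2 fun h ↦ hkl ?_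
      exact ⟨Subtype.ext (congrArg Prod.fst h), Subtype.ext (congrArg Prod.snd h)⟩
  have htri (x : Matrix.blockTriangularSubalgebra ℂ ℂ (id : ι → ι)) {k l : Set.Icc i j}
      (hlk : l < k) : φ x k l = 0 := x.2 hlk
  have hcol (x : Matrix.blockTriangularSubalgebra ℂ ℂ (id : ι → ι)) :
      φ x * Matrix.single i' j' (c i j) = x.1 i i • Matrix.single i' j' (c i j) :=
    mul_single_eq_smul (fun k hk ↦ htri x (lt_of_le_of_ne (a := i') k.2.1 hk.symm)) j' _
  have hrow (x : Matrix.blockTriangularSubalgebra ℂ ℂ (id : ι → ι)) :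
      Matrix.single i' j' (c i j) * φ x = x.1 j j • Matrix.single i' j' (c i j) :=
    single_mul_eq_smul (fun k hk ↦ htri x (lt_of_le_of_ne (b := j') k.2.2 hk)) i' _
  have hab_comm : Commute (φ a) (φ b) :=
    commute_of_exp_add_eq hcomm (hcol a) (hrow a) (hcol b) (hrow b) ha hb hab
      (exp_algHom_add_eq φ hexp)
  rw [hab_comm.eq, sub_self] at hcomm
  simpa using (congrFun₂ hcomm i' j').symm

theorem commute_of_isUpperTriangular_of_exp_add_eq {a b : Matrix ι ι ℂ}
    (ha : a.IsUpperTriangular) (hb : b.IsUpperTriangular)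
    (ha_im : ∀ z ∈ spectrum ℂ a, |z.im| < π) (hb_im : ∀ z ∈ spectrum ℂ b, |z.im| < π)
    (hab_im : ∀ z ∈ spectrum ℂ (a + b), |z.im| < π)
    (hexp : NormedSpace.exp (a + b) = NormedSpace.exp a * NormedSpace.exp b) : Commute a b := by
  have hdiag {x : Matrix ι ι ℂ} (hx : x.IsUpperTriangular)
      (hx_im : ∀ z ∈ spectrum ℂ x, |z.im| < π) (i j : ι) : |(x i i - x j j).im| < 2 * π := by
    have hi := hx_im _ (diag_mem_spectrum_of_isUpperTriangular hx i)
    have hj := hx_im _ (diag_mem_spectrum_of_isUpperTriangular hx j)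
    rw [Complex.sub_im, two_mul]
    exact (abs_sub _ _).trans_lt (add_lt_add hi hj)
  by_contra hne
  have hc : ∃ p : ιᵒᵈ × ι, (a * b - b * a) p.1.ofDual p.2 ≠ 0 := by
    by_contra! h
    exact hne (sub_eq_zero.mp (Matrix.ext fun i j ↦ h (OrderDual.toDual i, j)))
  obtain ⟨p, hp, hmin⟩ := exists_minimal_of_wellFoundedLT _ hc
  refine hp (commutator_apply_eq_zero_of_exp_add_eq (a := ⟨a, ha⟩) (b := ⟨b, hb⟩) hexp
    (fun k hk l hl hkl ↦ ?_) (hdiag ha ha_im _ _) (hdiag hb hb_im _ _) ?_)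
  · by_contra hne
    obtain ⟨hki, hjl⟩ := hmin (y := (OrderDual.toDual k, l)) hne ⟨hk.1, hl.2⟩
    exact hkl (Prod.ext (le_antisymm hki hk.1) (le_antisymm hl.2 hjl))
  · rw [sub_add_sub_comm]
    exact hdiag (ha.add hb) hab_im _ _

end UpperTriangular

section PrincipalLog

variable {n : ℕ} {x y a b : Matrix (Fin n) (Fin n) ℂ}

open scoped Matrix.Norms.Operator

theorem NoNonposEigenvalue.spectrum_subset_slitPlane (hx : NoNonposEigenvalue x) :
    spectrum ℂ x ⊆ Complex.slitPlane := by
  intro z hz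
  rw [Complex.mem_slitPlane_iff_not_le_zero]
  intro hz0
  obtain ⟨hre, him⟩ := Complex.nonpos_iff.mp hz0
  refine hx z.re hre ?_
  rwa [Complex.ext (Complex.ofReal_re z.re) ((Complex.ofReal_im z.re).trans him.symm)]

theorem isPrincipalLog_principalLog (hx : NoNonposEigenvalue x) :
    IsPrincipalLog x (principalLog x) := by
  have h : ∃ a, IsPrincipalLog x a :=
    let ⟨a, _, hexp, him⟩ := exists_mem_elemental_exp_eq hx.spectrum_subset_slitPlane
    ⟨a, hexp, fun z hz ↦ abs_lt.mp (him z hz)⟩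
  rw [principalLog, dif_pos h]
  exact h.choose_spec

theorem IsPrincipalLog.abs_im_lt (h : IsPrincipalLog x a) : ∀ z ∈ spectrum ℂ a, |z.im| < π :=
  fun z hz ↦ abs_lt.mpr (h.2 z hz)

theorem IsPrincipalLog.isUpperTriangular (h : IsPrincipalLog x a) (hx : x.IsUpperTriangular) :
    a.IsUpperTriangular :=
  mem_of_exp_mem (S := Matrix.blockTriangularSubalgebra ℂ ℂ id) h.abs_im_lt (h.1.symm ▸ hx)

theorem IsPrincipalLog.units_conj (h : IsPrincipalLog x a) (u : (Matrix (Fin n) (Fin n) ℂ)ˣ) :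
    IsPrincipalLog (u⁻¹.val * x * u.val) (u⁻¹.val * a * u.val) := by
  refine ⟨by rw [Matrix.exp_units_conj', h.1], ?_⟩
  rw [spectrum.units_conjugate']
  exact h.2

theorem IsPrincipalLog.commute_of_isUpperTriangular (ha : IsPrincipalLog x a)
    (hb : IsPrincipalLog y b) (hab : IsPrincipalLog (x * y) (a + b)) (hx : x.IsUpperTriangular)
    (hy : y.IsUpperTriangular) : Commute a b :=
  commute_of_isUpperTriangular_of_exp_add_eq (ha.isUpperTriangular hx) (hb.isUpperTriangular hy)
    ha.abs_im_lt hb.abs_im_lt hab.abs_im_lt (by rw [hab.1, ha.1, hb.1])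

theorem IsPrincipalLog.commute_of_simultaneouslyTriangularizable (ha : IsPrincipalLog x a)
    (hb : IsPrincipalLog y b) (hab : IsPrincipalLog (x * y) (a + b))
    (htri : SimultaneouslyTriangularizable x y) : Commute a b := by
  obtain ⟨_, ⟨u, rfl⟩, hx, hy⟩ := htri
  rw [← Matrix.coe_units_inv] at hx hy
  have hmul (s t : Matrix (Fin n) (Fin n) ℂ) :
      u⁻¹.val * (s * t) * u = (u⁻¹.val * s * u) * (u⁻¹.val * t * u) := by
    simp only [mul_assoc, Units.mul_inv_cancel_left]
  have hab_conj := hab.units_conj u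
  rw [hmul, mul_add, add_mul] at hab_conj
  have hcomm := ((ha.units_conj u).commute_of_isUpperTriangular (hb.units_conj u) hab_conj hx hy).eq
  rw [← hmul, ← hmul] at hcomm
  exact u⁻¹.isUnit.mul_left_cancel (u.isUnit.mul_right_cancel hcomm)

end PrincipalLog

theorem theorem2 (n : ℕ) (x y : Matrix (Fin n) (Fin n) ℂ)
    (hx : NoNonposEigenvalue x) (hy : NoNonposEigenvalue y) (hxy : NoNonposEigenvalue (x * y))
    (hlog : principalLog (x * y) = principalLog x + principalLog y)
    (htri : SimultaneouslyTriangularizable x y) :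
    x * y = y * x := by
  have hlog_x := isPrincipalLog_principalLog hx
  have hlog_y := isPrincipalLog_principalLog hy
  have hlog_xy := isPrincipalLog_principalLog hxy
  rw [hlog] at hlog_xy
  have hcomm := hlog_x.commute_of_simultaneouslyTriangularizable hlog_y hlog_xy htri
  have hexp_comm := hcomm.exp_left.exp_right
  rwa [hlog_x.1, hlog_y.1] at hexp_comm
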